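/- Let $R$ be an associative ring with identity. For right $R$-modules $M$ and $N$, say that $M$ is $N$-injective if every homomorphism from a submodule of $N$ to $M$ extends to a homomorphism $N \to M$. The injectivity domain of $M$ is the class $\mathfrak{In}^{-1}(M)$ of all right $R$-modules $N$ such that $M$ is $N$-injective, and the (right) injective profile $i\mathcal{P}(R)$ is the collection of the classes $\mathfrak{In}^{-1}(M)$, where $M$ ranges over all right $R$-modules, ordered by inclusion. If $R$ is right artinian, then $i\mathcal{P}(R)$ is a lattice, anti-isomorphic to the lattice of two-sided ideals of $R$ contained in the Jacobson radical $J(R)$ (both ordered by inclusion). In particular, $i\mathcal{P}(R)$ satisfies the descending chain condition and the ascending chain condition (it is an artinian and noetherian lattice). It has a least element and is atomic: every element other than the least one lies above an atom. -/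

import Mathlib

universe v u

/-- `M` is `N`-injective: every homomorphism to `M` from a submodule of `N` extends to `N`. -/
def IsRelInjective (S : Type*) [Ring S] (M N : Type*) [AddCommGroup M] [Module S M]
    [AddCommGroup N] [Module S N] : Prop :=
  ∀ (K : Submodule S N) (φ : K →ₗ[S] M), ∃ ψ : N →ₗ[S] M, ∀ x : K, ψ (x : N) = φ x

/-- The injectivity domain of a right `R`-module `M`: the class of all right `R`-modules `N`
such that `M` is `N`-injective. Right `R`-modules are modules over the opposite ring. -/
def injDomain {R : Type u} [Ring R] (M : ModuleCat.{max u v} Rᵐᵒᵖ) :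
    Set (ModuleCat.{max u v} Rᵐᵒᵖ) :=
  {N | IsRelInjective Rᵐᵒᵖ M N}

/-- The right injective profile of `R`: the collection of the injectivity domains of all right
`R`-modules. Coerced to a type, it is ordered by inclusion. -/
def iProfile (R : Type u) [Ring R] : Set (Set (ModuleCat.{max u v} Rᵐᵒᵖ)) :=
  {A | ∃ M : ModuleCat.{max u v} Rᵐᵒᵖ, A = injDomain.{v, u} M}

/-- The Jacobson radical of `R` (the intersection of all maximal left ideals, equivalently of all
maximal right ideals), as a two-sided ideal. -/
def jacobsonIdeal (R : Type u) [Ring R] : TwoSidedIdeal R := (Ring.jacobson R).toTwoSided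

/-!
Write `S = Rᵐᵒᵖ`, so that right `R`-modules are left `S`-modules. The elements of the injective
profile are exactly the classes `annihilatedClass I` of modules annihilated by a two-sided ideal
`I ≤ J(R)`. As `R ⧸ I` lies in the class of `L` only if `L ≤ I`, the correspondence reverses
inclusions both ways and so is an anti-isomorphism (`iProfileOrderIso`). The remaining claims are
transported along it: `R` is artinian and, by Hopkins–Levitzki, noetherian on the right, so both
chain conditions hold for two-sided ideals; the least class is the one belonging to `J(R)`.

*Every injectivity domain has this form* (`IsRelInjective.exists_ideal`). Fix `M`. The modules `N`
for which `M` is `N`-injective are closed under submodules, quotients and finite direct sums, and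
membership of `N` is decided by its cyclic submodules, by Zorn's lemma
(`IsRelInjective.of_forall_span_singleton`). So everything depends on the set of left ideals `L` of
`S` with `M` injective relative to `S ⧸ L`. This set is closed under intersections and `S` is
artinian, so it has a least element `I`. It is also closed under `L ↦ (L : s)`, which makes `I`
two-sided. It contains all maximal left ideals, since `M` is injective relative to every simple
module, so `I ≤ J(S)`.

*Every such class occurs* (`QuotientCharacter.isRelInjective_iff`). The injectivity domain of
`M = Hom_ℤ(S ⧸ I, ℚ/ℤ)` is the class of `I`. Maps `K → M` are the characters of `K` vanishing on
`I • K`. If `I • N = 0`, they extend to `N` because `ℚ/ℤ` is an injective abelian group. If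
`a • n ≠ 0` for some `a ∈ I` and `n : N`, let `K` be the submodule generated by `a • n`. Since
`I ≤ J(S)`, Nakayama's lemma gives `a • n ∉ I • K`, so there is a map `K → M` whose value at
`a • n` does not vanish at `1`. It has no extension `ψ : N → M`, since `ψ (a • n) = a • ψ n` vanishes
at `1`.
-/

universe w

/-! ### Closure properties of relative injectivity -/

namespace IsRelInjective

variable {S : Type*} [Ring S] {M N N' : Type*} [AddCommGroup M] [Module S M]
  [AddCommGroup N] [Module S N] [AddCommGroup N'] [Module S N']

theorem of_linearEquiv {M' : Type*} [AddCommGroup M'] [Module S M'] (e : M ≃ₗ[S] M')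
    (h : IsRelInjective S M N) : IsRelInjective S M' N := by
  intro K φ
  obtain ⟨ψ, hψ⟩ := h K (e.symm.toLinearMap ∘ₗ φ)
  exact ⟨e.toLinearMap ∘ₗ ψ, fun x => by simp [hψ]⟩

theorem of_injective (h : IsRelInjective S M N) (f : N' →ₗ[S] N) (hf : Function.Injective f) :
    IsRelInjective S M N' := by
  intro K φ
  let e := Submodule.equivMapOfInjective f hf K
  obtain ⟨ψ, hψ⟩ := h (K.map f) (φ ∘ₗ e.symm.toLinearMap)
  refine ⟨ψ ∘ₗ f, fun x => ?_⟩
  have := hψ (e x)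
  simpa [e] using this

theorem of_surjective (h : IsRelInjective S M N) (f : N →ₗ[S] N') (hf : Function.Surjective f) :
    IsRelInjective S M N' := by
  intro K φ
  obtain ⟨ψ, hψ⟩ := h (K.comap f) (φ ∘ₗ f.restrict (p := K.comap f) (q := K) fun _ hx => hx)
  have hker : LinearMap.ker f ≤ LinearMap.ker ψ := by
    intro x hx
    rw [LinearMap.mem_ker] at hx ⊢
    have hxK : x ∈ K.comap f := by simp [hx]
    rw [hψ ⟨x, hxK⟩]
    have : f.restrict (p := K.comap f) (q := K) (fun _ hx => hx) ⟨x, hxK⟩ = 0 :=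
      Subtype.ext hx
    rw [LinearMap.comp_apply, this, map_zero]
  refine ⟨(LinearMap.ker f).liftQ ψ hker ∘ₗ (f.quotKerEquivOfSurjective hf).symm.toLinearMap, ?_⟩
  rintro ⟨y, hy⟩
  obtain ⟨x, rfl⟩ := hf y
  have : (f.quotKerEquivOfSurjective hf).symm (f x) = Submodule.Quotient.mk x := by
    rw [LinearEquiv.symm_apply_eq]; rfl
  simp only [LinearMap.comp_apply, LinearEquiv.coe_coe, this]
  exact hψ ⟨x, hy⟩

theorem prod (h : IsRelInjective S M N) (h' : IsRelInjective S M N') :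
    IsRelInjective S M (N × N') := by
  intro K φ
  obtain ⟨ψ, hψ⟩ := h (K.comap (LinearMap.inl S N N'))
    (φ ∘ₗ (LinearMap.inl S N N').restrict fun _ hx => hx)
  let p : K →ₗ[S] N' := LinearMap.snd S N N' ∘ₗ K.subtype
  -- After subtracting `ψ`, the map `φ` factors through the projection of `K` to `N'`.
  let φ' : K →ₗ[S] M := φ - ψ ∘ₗ LinearMap.fst S N N' ∘ₗ K.subtype
  have hker : LinearMap.ker p ≤ LinearMap.ker φ' := by
    rintro ⟨⟨a, b⟩, hab⟩ hx
    obtain rfl : b = 0 := hx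
    have := hψ ⟨a, hab⟩
    simp only [φ', LinearMap.mem_ker, LinearMap.sub_apply, sub_eq_zero]
    exact this.symm
  obtain ⟨χ, hχ⟩ := h' (LinearMap.range p)
    ((LinearMap.ker p).liftQ φ' hker ∘ₗ p.quotKerEquivRange.symm.toLinearMap)
  refine ⟨ψ ∘ₗ LinearMap.fst S N N' + χ ∘ₗ LinearMap.snd S N N', fun x => ?_⟩
  have := hχ ⟨p x, x, rfl⟩
  have e : p.quotKerEquivRange.symm ⟨p x, x, rfl⟩ = Submodule.Quotient.mk x := by
    rw [LinearEquiv.symm_apply_eq]; rfl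
  simp only [LinearMap.comp_apply, LinearEquiv.coe_coe, e] at this
  have h2 : χ (x : N × N').2 = φ x - ψ (x : N × N').1 := this
  simp [h2]

/-- A form of Baer's criterion: relative injectivity is decided on the cyclic submodules. A maximal
extension of a given map is defined everywhere, since otherwise it could be extended to one more
cyclic submodule. -/
theorem of_forall_span_singleton (h : ∀ x : N, IsRelInjective S M (Submodule.span S {x})) :
    IsRelInjective S M N := by
  intro K φ
  obtain ⟨g, hg, hmax⟩ := zorn_le_nonempty₀ {f : N →ₗ.[S] M | LinearPMap.mk K φ ≤ f} (by
    intro c hc hchain y hy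
    exact ⟨LinearPMap.sSup c hchain.directedOn,
      (hc hy).trans (LinearPMap.le_sSup hchain.directedOn hy),
      fun z hz => LinearPMap.le_sSup hchain.directedOn hz⟩)
    (LinearPMap.mk K φ) (le_refl (LinearPMap.mk K φ))
  have htop : g.domain = ⊤ := by
    refine eq_top_iff.2 fun x _ => ?_
    obtain ⟨ψ, hψ⟩ := h x (g.domain.comap (Submodule.span S {x}).subtype)
      (g.toFun ∘ₗ (Submodule.span S {x}).subtype.restrict fun _ hx => hx)
    have H : ∀ (a : g.domain) (b : (LinearPMap.mk (Submodule.span S {x}) ψ).domain),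
        (a : N) = b → g a = LinearPMap.mk (Submodule.span S {x}) ψ b := by
      rintro ⟨a, ha⟩ ⟨b, hb⟩ (rfl : a = b)
      exact (hψ ⟨⟨a, hb⟩, ha⟩).symm
    exact (hmax.2 (hg.trans (LinearPMap.left_le_sup g _ H)) (LinearPMap.left_le_sup g _ H)).1
      ((LinearPMap.right_le_sup g _ H).1 (Submodule.mem_span_singleton_self x))
  refine ⟨g.toFun ∘ₗ (LinearMap.id.codRestrict g.domain fun x => by simp [htop]), fun x => ?_⟩
  exact (hg.2 (x := x) (y := ⟨x, by simp [htop]⟩) rfl).symm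

end IsRelInjective

/-! ### Left-right symmetry of the Jacobson radical -/

namespace Ring

theorem isUnit_one_add_of_mem_jacobson {A : Type*} [Ring A] {x : A} (hx : x ∈ Ring.jacobson A) :
    IsUnit (1 + x) := by
  have left_inv : ∀ x ∈ Ring.jacobson A, ∃ z, z * (1 + x) = 1 := by
    intro x hx
    rw [← Ideal.jacobson_bot, Ideal.mem_jacobson_iff] at hx
    obtain ⟨z, hz⟩ := hx 1
    refine ⟨z, ?_⟩
    rw [Submodule.mem_bot, sub_eq_zero] at hz
    rwa [mul_one, add_comm, ← mul_one_add] at hz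
  obtain ⟨z, hz⟩ := left_inv x hx
  -- The left inverse `z` has the form `1 + x'` with `x' ∈ J`, so it has a left inverse as well.
  obtain ⟨w, hw⟩ := left_inv (-(z * x)) (neg_mem (Ideal.mul_mem_left _ z hx))
  have hz' : 1 + -(z * x) = z := by rw [← hz]; noncomm_ring
  rw [hz'] at hw
  exact ⟨⟨1 + x, z, by rw [← left_inv_eq_right_inv hw hz]; exact hw, hz⟩, rfl⟩

/-- One half of the left-right symmetry of the Jacobson radical: if `x ∈ J` then every `1 + x * y`
is a unit, in particular right invertible. -/
theorem op_mem_jacobson {A : Type*} [Ring A] {x : A} (hx : x ∈ Ring.jacobson A) :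
    MulOpposite.op x ∈ Ring.jacobson Aᵐᵒᵖ := by
  rw [← Ideal.jacobson_bot, Ideal.mem_jacobson_iff]
  intro y
  obtain ⟨u, hu⟩ := isUnit_one_add_of_mem_jacobson (Ideal.mul_mem_right y.unop _ hx)
  refine ⟨MulOpposite.op ↑u⁻¹, ?_⟩
  have := u.mul_inv
  rw [hu, add_mul, one_mul] at this
  rw [Submodule.mem_bot, sub_eq_zero]
  apply MulOpposite.unop_injective
  simpa [mul_assoc, add_comm] using this

theorem op_mem_jacobson_iff {A : Type*} [Ring A] {x : A} :
    MulOpposite.op x ∈ Ring.jacobson Aᵐᵒᵖ ↔ x ∈ Ring.jacobson A := by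
  refine ⟨fun hx => ?_, op_mem_jacobson⟩
  have := Ring.le_comap_jacobson ((RingEquiv.opOp A).symm : Aᵐᵒᵖᵐᵒᵖ →+* A) (op_mem_jacobson hx)
  simpa using this

end Ring

/-! ### Injectivity domains are given by two-sided ideals -/

namespace IsRelInjective

section

variable {S : Type*} [Ring S] {M : Type*} [AddCommGroup M] [Module S M]

theorem iff_forall_quotient_ker {N : Type*} [AddCommGroup N] [Module S N] :
    IsRelInjective S M N ↔
      ∀ x : N, IsRelInjective S M (S ⧸ LinearMap.ker (LinearMap.toSpanSingleton S N x)) := by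
  refine ⟨fun h x => h.of_injective _
    (LinearMap.ker_eq_bot.1 (Submodule.ker_liftQ_eq_bot' _ (LinearMap.toSpanSingleton S N x) rfl)),
    fun h => of_forall_span_singleton fun x => ?_⟩
  rw [← LinearMap.range_toSpanSingleton]
  exact (h x).of_surjective (LinearMap.quotKerEquivRange _).toLinearMap
    (LinearMap.quotKerEquivRange _).surjective

theorem of_isSimpleModule {N : Type*} [AddCommGroup N] [Module S N] [IsSimpleModule S N] :
    IsRelInjective S M N := by
  intro K φ
  obtain rfl | rfl := eq_bot_or_eq_top K
  · exact ⟨0, fun x => by simp [Subsingleton.elim x 0]⟩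
  · exact ⟨φ ∘ₗ Submodule.topEquiv.symm.toLinearMap, fun x => rfl⟩

theorem quotient_of_le {I L : Ideal S} (h : IsRelInjective S M (S ⧸ I)) (hIL : I ≤ L) :
    IsRelInjective S M (S ⧸ L) :=
  h.of_surjective (Submodule.factor hIL) (Submodule.factor_surjective hIL)

theorem quotient_inf {I L : Ideal S} (hI : IsRelInjective S M (S ⧸ I))
    (hL : IsRelInjective S M (S ⧸ L)) : IsRelInjective S M (S ⧸ (I ⊓ L)) := by
  refine (hI.prod hL).of_injective (Submodule.liftQ (I ⊓ L) (I.mkQ.prod L.mkQ) ?_) ?_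
  · rw [LinearMap.ker_prod, Submodule.ker_mkQ, Submodule.ker_mkQ]
  · rw [← LinearMap.ker_eq_bot]
    apply Submodule.ker_liftQ_eq_bot'
    rw [LinearMap.ker_prod, Submodule.ker_mkQ, Submodule.ker_mkQ]

/-- Right multiplication by `s` embeds `S ⧸ (I : s)` into `S ⧸ I`. -/
theorem quotient_comap {I : Ideal S} (hI : IsRelInjective S M (S ⧸ I)) (s : S) :
    IsRelInjective S M (S ⧸ Submodule.comap (LinearMap.toSpanSingleton S S s) I) := by
  refine hI.of_injective (Submodule.liftQ _ (I.mkQ ∘ₗ LinearMap.toSpanSingleton S S s) ?_) ?_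
  · rw [LinearMap.ker_comp, Submodule.ker_mkQ]
  · rw [← LinearMap.ker_eq_bot]
    apply Submodule.ker_liftQ_eq_bot'
    rw [LinearMap.ker_comp, Submodule.ker_mkQ]

end

/-- Over an artinian ring the injectivity domain of `M` consists of the modules annihilated by the
least left ideal `I` for which `M` is injective relative to `S ⧸ I`. -/
theorem exists_ideal {S : Type u} [Ring S] [IsArtinianRing S] (M : Type*) [AddCommGroup M]
    [Module S M] : ∃ I : Ideal S, I.IsTwoSided ∧ I ≤ Ring.jacobson S ∧
      ∀ (N : Type w) [AddCommGroup N] [Module S N],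
        IsRelInjective S M N ↔ ∀ a ∈ I, ∀ n : N, a • n = 0 := by
  obtain ⟨I, hI, hmin⟩ := IsArtinian.set_has_minimal {L : Ideal S | IsRelInjective S M (S ⧸ L)}
    ⟨⊤, fun K φ => ⟨0, fun x => by simp [Subsingleton.elim x 0]⟩⟩
  have hle : ∀ L : Ideal S, IsRelInjective S M (S ⧸ L) → I ≤ L := fun L hL =>
    inf_eq_left.1 (eq_of_le_of_not_lt inf_le_left (hmin _ (quotient_inf hI hL)))
  refine ⟨I, ⟨fun s ha => hle _ (quotient_comap hI s) ha⟩, ?_, fun N _ _ => ?_⟩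
  · refine le_sInf fun L hL => hle L ?_
    have : IsSimpleModule S (S ⧸ L) := isSimpleModule_iff_isCoatom.2 hL
    exact of_isSimpleModule
  · rw [iff_forall_quotient_ker]
    exact ⟨fun h a ha n => hle _ (h n) ha, fun h x => quotient_of_le hI fun a ha => h a ha x⟩

end IsRelInjective

/-! ### A module with prescribed injectivity domain -/

/-- The left `S`-module of additive maps `S → ℚ/ℤ` that vanish on the two-sided ideal `I`, that is,
the character module of the right `S`-module `S ⧸ I`. The action is `(s • g) t = g (t * s)`. -/
def QuotientCharacter {S : Type*} [Ring S] (I : TwoSidedIdeal S) : Type _ :=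
  {g : S →+ AddCircle (1 : ℚ) // ∀ a ∈ I, g a = 0}

namespace QuotientCharacter

variable {S : Type*} [Ring S] (I : TwoSidedIdeal S)

instance : AddCommGroup (QuotientCharacter I) :=
  inferInstanceAs (AddCommGroup
    ({ carrier := {g | ∀ a ∈ I, g a = 0}
       zero_mem' := fun _ _ => rfl
       add_mem' := fun hf hg a ha => by simp [hf a ha, hg a ha]
       neg_mem' := fun hf a ha => by simp [hf a ha] } : AddSubgroup (S →+ AddCircle (1 : ℚ))))

variable {I}

@[ext] theorem ext {f g : QuotientCharacter I} (h : ∀ t, f.1 t = g.1 t) : f = g :=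
  Subtype.ext (DFunLike.ext _ _ h)

instance : SMul S (QuotientCharacter I) :=
  ⟨fun s g => ⟨g.1.comp (AddMonoidHom.mulRight s), fun a ha => g.2 _ (I.mul_mem_right a s ha)⟩⟩

theorem smul_apply (s : S) (g : QuotientCharacter I) (t : S) : (s • g).1 t = g.1 (t * s) := rfl

theorem add_apply (f g : QuotientCharacter I) (t : S) : (f + g).1 t = f.1 t + g.1 t := rfl

theorem zero_apply (t : S) : (0 : QuotientCharacter I).1 t = 0 := rfl

instance : Module S (QuotientCharacter I) where
  one_smul g := by ext t; simp [smul_apply]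
  mul_smul r s g := by ext t; simp [smul_apply, mul_assoc]
  smul_zero s := by ext t; simp [smul_apply, zero_apply]
  smul_add s f g := by ext t; simp [smul_apply, add_apply]
  add_smul r s g := by ext t; simp [smul_apply, add_apply, mul_add]
  zero_smul g := by ext t; simp [smul_apply, zero_apply]

variable {N : Type*} [AddCommGroup N] [Module S N]

/-- The `S`-linear map `n ↦ (t ↦ c (t • n))` attached to a character `c` of `N` that vanishes on
`I • N`. -/
def ofCharacter (c : N →+ AddCircle (1 : ℚ)) (hc : ∀ a ∈ I, ∀ n : N, c (a • n) = 0) :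
    N →ₗ[S] QuotientCharacter I where
  toFun n := ⟨c.comp ((smulAddHom S N).flip n), fun a ha => hc a ha n⟩
  map_add' m n := by
    ext t
    change c (t • (m + n)) = c (t • m) + c (t • n)
    rw [smul_add, map_add]
  map_smul' s n := by
    ext t
    change c (t • s • n) = c ((t * s) • n)
    rw [mul_smul]

theorem ofCharacter_apply (c : N →+ AddCircle (1 : ℚ)) (hc : ∀ a ∈ I, ∀ n : N, c (a • n) = 0)
    (n : N) (t : S) : (ofCharacter c hc n).1 t = c (t • n) := rfl

theorem isRelInjective_of_annihilated (h : ∀ a ∈ I, ∀ n : N, a • n = 0) :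
    IsRelInjective S (QuotientCharacter I) N := by
  intro K φ
  -- A map `φ` into the character module is determined by the character `x ↦ φ x 1`.
  let c : K →+ AddCircle (1 : ℚ) :=
    { toFun := fun x => (φ x).1 1
      map_zero' := by rw [map_zero, zero_apply]
      map_add' := fun x y => by rw [map_add, add_apply] }
  obtain ⟨d, hd⟩ : ∃ d : N →+ AddCircle (1 : ℚ), ∀ x : K, d x = c x := by
    obtain ⟨d, hd⟩ := CharacterModule.dual_surjective_of_injective
      (K.subtype.toAddMonoidHom.toIntLinearMap) K.injective_subtype c
    exact ⟨d, DFunLike.congr_fun hd⟩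
  refine ⟨ofCharacter d fun a ha n => by rw [h a ha, map_zero], fun x => ?_⟩
  ext t
  have h1 : d (t • (x : N)) = c (t • x) := hd (t • x)
  rw [ofCharacter_apply, h1]
  change (φ (t • x)).1 1 = _
  rw [map_smul, smul_apply, one_mul]

theorem annihilated_of_isRelInjective (hI : I.asIdeal ≤ Ring.jacobson S)
    (h : IsRelInjective S (QuotientCharacter I) N) : ∀ a ∈ I, ∀ n : N, a • n = 0 := by
  intro a ha n
  by_contra hne
  let K := Submodule.span S {a • n}
  have hKx : a • n ∈ K := Submodule.mem_span_singleton_self _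
  have hx : a • n ∉ I.asIdeal • K := by
    intro hx
    have hK : K = ⊥ := by
      refine (Submodule.fg_span_singleton (a • n)).eq_bot_of_le_jacobson_smul ?_
      rw [Submodule.span_singleton_le_iff_mem]
      exact Submodule.smul_mono_left hI hx
    exact hne (Submodule.span_singleton_eq_bot.1 hK)
  let IK : Submodule S K := (I.asIdeal • K).comap K.subtype
  have hx' : IK.mkQ ⟨a • n, hKx⟩ ≠ 0 := by
    rw [Ne, Submodule.mkQ_apply, Submodule.Quotient.mk_eq_zero]
    exact hx
  -- A character of `K ⧸ I • K` that does not vanish at `a • n` gives a map from `K` to extend.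
  obtain ⟨c, hc⟩ := CharacterModule.exists_character_apply_ne_zero_of_ne_zero hx'
  obtain ⟨ψ, hψ⟩ := h K (ofCharacter (c.comp IK.mkQ.toAddMonoidHom) fun b hb k => by
    have : IK.mkQ (b • k) = 0 := by
      rw [Submodule.mkQ_apply, Submodule.Quotient.mk_eq_zero]
      exact Submodule.smul_mem_smul (TwoSidedIdeal.mem_asIdeal.2 hb) k.2
    change c (IK.mkQ (b • k)) = 0
    rw [this, map_zero])
  refine hc ?_
  have h1 := congrArg (fun g => g.1 1) (hψ ⟨a • n, hKx⟩)
  simp only [ofCharacter_apply, one_smul] at h1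
  refine Eq.trans h1.symm ?_
  -- `ψ (a • n) = a • ψ n`, evaluated at `1`, is the value of `ψ n` at `a ∈ I`.
  rw [map_smul, smul_apply, one_mul]
  exact (ψ n).2 a ha

theorem isRelInjective_iff (hI : I.asIdeal ≤ Ring.jacobson S) :
    IsRelInjective S (QuotientCharacter I) N ↔ ∀ a ∈ I, ∀ n : N, a • n = 0 :=
  ⟨annihilated_of_isRelInjective hI, isRelInjective_of_annihilated⟩

end QuotientCharacter

/-! ### The injective profile -/

open MulOpposite

/-- The class of all right `R`-modules annihilated by the two-sided ideal `I`; the right action of `a`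
on a module is the action of `op a`. -/
def annihilatedClass {R : Type u} [Ring R] (I : TwoSidedIdeal R) :
    Set (ModuleCat.{max u v} Rᵐᵒᵖ) :=
  {N | ∀ a ∈ I, ∀ n : N, op a • n = 0}

theorem annihilatedClass_subset_iff {R : Type u} [Ring R] {I L : TwoSidedIdeal R} :
    annihilatedClass.{v} I ⊆ annihilatedClass.{v} L ↔ L ≤ I := by
  refine ⟨fun h a ha => ?_, fun h N hN a ha => hN a (h ha)⟩
  -- The cyclic module `R ⧸ I` is annihilated by exactly the elements of `I`.
  let N := ModuleCat.of.{max u v} Rᵐᵒᵖ (ULift.{v} (Rᵐᵒᵖ ⧸ I.op.asIdeal))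
  have hN : N ∈ annihilatedClass.{v} I := by
    rintro b hb ⟨n⟩
    obtain ⟨t, rfl⟩ := Submodule.mkQ_surjective _ n
    refine ULift.ext _ _ ((Submodule.Quotient.mk_eq_zero I.op.asIdeal (x := op b * t)).2 ?_)
    exact TwoSidedIdeal.mem_asIdeal.2
      (I.op.mul_mem_right _ _ (TwoSidedIdeal.mem_op_iff.2 hb))
  have := congrArg ULift.down (h hN a ha ⟨Submodule.Quotient.mk 1⟩)
  have h1 : op a * 1 ∈ I.op.asIdeal := (Submodule.Quotient.mk_eq_zero I.op.asIdeal).1 this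
  rw [mul_one, TwoSidedIdeal.mem_asIdeal, TwoSidedIdeal.mem_op_iff] at h1
  exact h1

variable {R : Type u} [Ring R]

theorem le_jacobsonIdeal_iff {I : TwoSidedIdeal R} :
    I ≤ jacobsonIdeal R ↔ I.op.asIdeal ≤ Ring.jacobson Rᵐᵒᵖ := by
  constructor
  · intro h a ha
    have := h (TwoSidedIdeal.mem_op_iff.1 (TwoSidedIdeal.mem_asIdeal.1 ha))
    exact Ring.op_mem_jacobson (Ideal.mem_toTwoSided.1 this)
  · intro h a ha
    exact Ideal.mem_toTwoSided.2 (Ring.op_mem_jacobson_iff.1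
      (h (TwoSidedIdeal.mem_asIdeal.2 (TwoSidedIdeal.mem_op_iff.2 ha))))

theorem annihilatedClass_mem_iProfile {I : TwoSidedIdeal R} (hI : I ≤ jacobsonIdeal R) :
    annihilatedClass.{v} I ∈ iProfile.{v, u} R := by
  refine ⟨ModuleCat.of Rᵐᵒᵖ (ULift.{v} (QuotientCharacter I.op)), Set.ext fun N => ?_⟩
  have key := QuotientCharacter.isRelInjective_iff (N := N) (le_jacobsonIdeal_iff.1 hI)
  let e : QuotientCharacter I.op ≃ₗ[Rᵐᵒᵖ] ULift.{v} (QuotientCharacter I.op) :=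
    ULift.moduleEquiv.symm
  constructor
  · intro hN
    exact (key.2 fun a ha n => hN a.unop (TwoSidedIdeal.mem_op_iff.1 ha) n).of_linearEquiv e
  · intro hN a ha n
    exact key.1 (IsRelInjective.of_linearEquiv e.symm hN) (op a) (TwoSidedIdeal.mem_op_iff.2 ha) n

theorem exists_annihilatedClass_eq [IsArtinianRing Rᵐᵒᵖ] {A : Set (ModuleCat.{max u v} Rᵐᵒᵖ)}
    (hA : A ∈ iProfile.{v, u} R) : ∃ I ≤ jacobsonIdeal R, annihilatedClass.{v} I = A := by
  obtain ⟨M, rfl⟩ := hA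
  obtain ⟨I, _, hIJ, hI⟩ := IsRelInjective.exists_ideal.{u, max u v} (S := Rᵐᵒᵖ) M
  refine ⟨I.toTwoSided.unop, ?_, Set.ext fun N => ?_⟩
  · rw [le_jacobsonIdeal_iff]
    intro a ha
    exact hIJ (Ideal.mem_toTwoSided.1 ha)
  · refine Iff.trans ?_ (hI N).symm
    exact ⟨fun h a ha n => h a.unop (TwoSidedIdeal.mem_unop_iff.2 (Ideal.mem_toTwoSided.2 ha)) n,
      fun h a ha n => h (op a) (Ideal.mem_toTwoSided.1 (TwoSidedIdeal.mem_unop_iff.1 ha)) n⟩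

/-- The anti-isomorphism between the two-sided ideals contained in the Jacobson radical and the
injective profile: `I` corresponds to the class of modules annihilated by `I`. -/
noncomputable def iProfileOrderIso (R : Type u) [Ring R] [IsArtinianRing Rᵐᵒᵖ] :
    (Set.Iic (jacobsonIdeal R))ᵒᵈ ≃o iProfile.{v, u} R :=
  RelIso.ofSurjective
    (OrderEmbedding.ofMapLEIff
      (fun I => ⟨annihilatedClass (OrderDual.ofDual I).1,
        annihilatedClass_mem_iProfile (OrderDual.ofDual I).2⟩)
      fun _ _ => annihilatedClass_subset_iff)
    fun A => by
      obtain ⟨I, hI, h⟩ := exists_annihilatedClass_eq A.2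
      exact ⟨OrderDual.toDual ⟨I, hI⟩, Subtype.ext h⟩

/-- A two-sided ideal of `R` viewed as a right ideal, that is, as a left ideal of `Rᵐᵒᵖ`. -/
def TwoSidedIdeal.opIdealEmbedding (R : Type*) [Ring R] : TwoSidedIdeal R ↪o Ideal Rᵐᵒᵖ :=
  OrderEmbedding.ofMapLEIff (fun I => I.op.asIdeal) fun _ _ =>
    ⟨fun h a ha => TwoSidedIdeal.mem_op_iff.1 (TwoSidedIdeal.mem_asIdeal.1
        (h (TwoSidedIdeal.mem_asIdeal.2 ((TwoSidedIdeal.mem_op_iff (x := MulOpposite.op a)).2 ha)))),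
      fun h _ ha => TwoSidedIdeal.mem_asIdeal.2 (TwoSidedIdeal.mem_op_iff.2
        (h (TwoSidedIdeal.mem_op_iff.1 (TwoSidedIdeal.mem_asIdeal.1 ha))))⟩

theorem proposition2p10 (R : Type u) [Ring R] [IsArtinianRing Rᵐᵒᵖ] :
    Nonempty (iProfile.{v, u} R ≃o (Set.Iic (jacobsonIdeal R))ᵒᵈ) ∧
    (∀ A B : iProfile.{v, u} R, (∃ C, IsGLB {A, B} C) ∧ (∃ C, IsLUB {A, B} C)) ∧
    WellFoundedLT (iProfile.{v, u} R) ∧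
    WellFoundedGT (iProfile.{v, u} R) ∧
    ∃ _ : OrderBot (iProfile.{v, u} R), IsAtomic (iProfile.{v, u} R) := by
  let e := (iProfileOrderIso.{v, u} R).symm
  let ι : Set.Iic (jacobsonIdeal R) ↪o Ideal Rᵐᵒᵖ :=
    (OrderEmbedding.subtype _).trans (TwoSidedIdeal.opIdealEmbedding R)
  have : WellFoundedLT (Set.Iic (jacobsonIdeal R)) := ι.wellFoundedLT
  -- Noetherianity of the right artinian ring `R` is the Hopkins–Levitzki theorem.
  have : WellFoundedGT (Set.Iic (jacobsonIdeal R)) := ι.wellFoundedGT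
  have hlt : WellFoundedLT (iProfile.{v, u} R) := e.toOrderEmbedding.wellFoundedLT
  have hgt : WellFoundedGT (iProfile.{v, u} R) := e.toOrderEmbedding.wellFoundedGT
  refine ⟨⟨e⟩, fun A B => ⟨⟨e.symm (e A ⊓ e B), ?_⟩, ⟨e.symm (e A ⊔ e B), ?_⟩⟩, hlt, hgt, ?_⟩
  · have := (e.symm.isGLB_image' (s := {e A, e B}) (x := e A ⊓ e B)).2 isGLB_pair
    simpa [Set.image_pair] using this
  · have := (e.symm.isLUB_image' (s := {e A, e B}) (x := e A ⊔ e B)).2 isLUB_pair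
    simpa [Set.image_pair] using this
  · let _ : OrderBot (iProfile.{v, u} R) :=
      { bot := e.symm ⊥
        bot_le := fun A => (e.symm_apply_le).2 bot_le }
    exact ⟨inferInstance, isAtomic_of_orderBot_wellFounded_lt hlt.wf⟩
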